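/- **Setting.** Let $(\Omega,\mathcal F,\mu)$ be a complete $\sigma$-finite measure space and let $(\mathsf H_\omega)_{\omega\in\Omega}$ be a family of real Hilbert spaces. Let $\mathfrak G$ be a vector subspace of $\prod_{\omega\in\Omega}\mathsf H_\omega$ such that * for every $x\in\mathfrak G$, the function $\omega\mapsto\|x(\omega)\|$ is $\mathcal F$-measurable; * every $x\in\prod_{\omega}\mathsf H_\omega$ such that $\omega\mapsto\langle x(\omega),y(\omega)\rangle$ is $\mathcal F$-measurable for all $y\in\mathfrak G$ belongs to $\mathfrak G$; * there is a sequence $(e_n)_{n\in\mathbb N}$ in $\mathfrak G$ such that, for every $\omega\in\Omega$, the closed linear span of $\{e_n(\omega)\}_{n\in\mathbb N}$ is $\mathsf H_\omega$. Let $\mathfrak H=\{x\in\mathfrak G : \int_\Omega\|x(\omega)\|^2\,\mu(d\omega)<+\infty\}$, and let $\mathcal H$ be the Hilbert space of classes of $\mu$-a.e. equal elements of $\mathfrak H$ with scalar product $\langle x,y\rangle=\int_\Omega\langle x(\omega),y(\omega)\rangle\,\mu(d\omega)$ (the Hilbert direct integral). For operators $\mathsf A_\omega\colon\mathsf H_\omega\to2^{\mathsf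 H_\omega}$, their direct integral is the operator $\mathcal H\to2^{\mathcal H}$ that maps $x$ to $\{x^*\in\mathcal H : x^*(\omega)\in\mathsf A_\omega x(\omega)\text{ for }\mu\text{-a.e. }\omega\}$. An operator $S$ on a real Hilbert space is $\sigma$-cocoercive if $\langle x-y,Sx-Sy\rangle\ge\sigma\|Sx-Sy\|^2$ for all $x,y$. **Proposition.** Let $\mathsf X$ be a separable real Hilbert space, let $\beta\colon\Omega\to\,]0,+\infty[$ be $\mathcal F$-measurable with $\operatorname{ess\,sup}\beta<+\infty$, and, for every $\omega\in\Omega$, let $\mathsf T_\omega\colon\mathsf H_\omega\to\mathsf H_\omega$ be $\beta(\omega)$-Lipschitzian and let $\mathsf L_\omega\colon\mathsf X\to\mathsf H_\omega$ be linear and bounded. Suppose that * (A) for every $x\in\mathfrak H$, the mapping $\omega\mapsto\mathsf T_\omega x(\omega)$ lies in $\mathfrak G$; * (B) there exists $z\in\mathfrak H$ such that $\omega\mapsto\mathsf T_\omega z(\omega)$ lies in $\mathfrak H$; * (C) for every $\mathsf x\in\mathsf X$, the mapping $\omega\mapsto\mathsf L_\omega\mathsf x$ lies in $\mathfrak G$;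 * (D) $\int_\Omega\|\mathsf L_\omega\|^2\,\mu(d\omega)<+\infty$. Define $\mathsf T\mathsf x=\int_\Omega\mathsf L_\omega^*\big(\mathsf T_\omega(\mathsf L_\omega\mathsf x)\big)\,\mu(d\omega)$ (Bochner integral) and $\tau=\int_\Omega\|\mathsf L_\omega\|^2\beta(\omega)\,\mu(d\omega)$. Then the following hold. 1. For every $\mathsf x\in\mathsf X$ the integrand $\omega\mapsto\mathsf L_\omega^*(\mathsf T_\omega(\mathsf L_\omega\mathsf x))$ is measurable and integrable, so that $\mathsf T\colon\mathsf X\to\mathsf X$ is well defined; moreover $\tau<+\infty$ and $\mathsf T$ is $\tau$-Lipschitzian. 2. For every $\mathsf x\in\mathsf X$ the mapping $\omega\mapsto\mathsf L_\omega\mathsf x$ lies in $\mathfrak H$. The operator $L\colon\mathsf X\to\mathcal H$ that maps $\mathsf x$ to its class is linear and bounded, with $\|L\|\le\sqrt{\int_\Omega\|\mathsf L_\omega\|^2\,\mu(d\omega)}$. The direct integral $T$ of $(\mathsf T_\omega)_{\omega\in\Omega}$ is a single-valued operator $T\colon\mathcal H\to\mathcal H$ defined everywhere, and $\mathsf T=L^*\circ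 T\circ L$. 3. Suppose in addition that, for every $\omega\in\Omega$, $\mathsf T_\omega$ is $1/\beta(\omega)$-cocoercive and $\mathsf L_\omega\ne0$. Then: * (a) $\mathsf T$ is $1/\tau$-cocoercive, where $\tau>0$ unless $\mu=0$ (if $\mu=0$, then $\tau=0$, $\mathsf T=0$, and $1/\tau$ is read as $0$); * (b) for every $x\in\mathfrak H$, $\omega\mapsto\mathsf L_\omega^*(\mathsf T_\omega x(\omega))$ is integrable, and $\Big\{\int_\Omega\mathsf L_\omega^*(\mathsf T_\omega x(\omega))\,\mu(d\omega) : x\in\mathfrak H\Big\}\subset\overline{\operatorname{ran}}\,\mathsf T$; * (c) $\operatorname{int}\Big\{\int_\Omega\mathsf L_\omega^*(\mathsf T_\omega x(\omega))\,\mu(d\omega) : x\in\mathfrak H\Big\}\subset\operatorname{ran}\mathsf T$. -/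

import Mathlib

open MeasureTheory Filter Topology
open scoped ENNReal NNReal

noncomputable section

/-- An `F`-measurable vector field of real Hilbert spaces: a vector subspace `𝔊` of the product
`∏ ω, H ω` satisfying the three axioms of a Hilbert direct integral. -/
structure MeasurableVectorField {Ω : Type*} [MeasurableSpace Ω] (H : Ω → Type*)
    [∀ ω, NormedAddCommGroup (H ω)] [∀ ω, InnerProductSpace ℝ (H ω)] where
  /-- The vector subspace `𝔊` of `∏ ω, H ω`. -/
  toSubmodule : Submodule ℝ (∀ ω, H ω)
  /-- `ω ↦ ‖x ω‖` is measurable for every `x ∈ 𝔊`. -/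
  measurable_norm : ∀ x ∈ toSubmodule, Measurable fun ω => ‖x ω‖
  /-- `x` belongs to `𝔊` as soon as `ω ↦ ⟪x ω, y ω⟫` is measurable for every `y ∈ 𝔊`. -/
  mem_of_measurable_inner : ∀ x : ∀ ω, H ω,
    (∀ y ∈ toSubmodule, Measurable fun ω => inner ℝ (x ω) (y ω)) → x ∈ toSubmodule
  /-- There is a sequence in `𝔊` which, at every `ω`, has dense linear span in `H ω`. -/
  exists_fundamental : ∃ e : ℕ → ∀ ω, H ω, (∀ n, e n ∈ toSubmodule) ∧
    ∀ ω, (Submodule.span ℝ (Set.range fun n => e n ω)).topologicalClosure = ⊤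

namespace MeasurableVectorField

variable {Ω : Type*} [MeasurableSpace Ω] {H : Ω → Type*}
  [∀ ω, NormedAddCommGroup (H ω)] [∀ ω, InnerProductSpace ℝ (H ω)]

theorem measurable_inner (𝔊 : MeasurableVectorField H) {x y : ∀ ω, H ω}
    (hx : x ∈ 𝔊.toSubmodule) (hy : y ∈ 𝔊.toSubmodule) :
    Measurable fun ω => inner ℝ (x ω) (y ω) := by
  have h : (fun ω => inner ℝ (x ω) (y ω))
      = fun ω => (‖(x + y) ω‖ * ‖(x + y) ω‖ - ‖x ω‖ * ‖x ω‖ - ‖y ω‖ * ‖y ω‖) / 2 := by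
    funext ω
    exact real_inner_eq_norm_add_mul_self_sub_norm_mul_self_sub_norm_mul_self_div_two _ _
  rw [h]
  have h1 := 𝔊.measurable_norm _ (𝔊.toSubmodule.add_mem hx hy)
  have h2 := 𝔊.measurable_norm _ hx
  have h3 := 𝔊.measurable_norm _ hy
  fun_prop

theorem measurable_enorm (𝔊 : MeasurableVectorField H) {x : ∀ ω, H ω}
    (hx : x ∈ 𝔊.toSubmodule) : Measurable fun ω => ‖x ω‖ₑ := by
  have h := (𝔊.measurable_norm _ hx).ennreal_ofReal
  simpa [ofReal_norm] using h

/-- The space `𝔥 = {x ∈ 𝔊 | ∫ ‖x ω‖² dμ < ∞}` of square-integrable mappings. -/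
def squareIntegrable (𝔊 : MeasurableVectorField H) (μ : Measure Ω) :
    Submodule ℝ (∀ ω, H ω) where
  carrier := {x | x ∈ 𝔊.toSubmodule ∧ ∫⁻ ω, ‖x ω‖ₑ ^ 2 ∂μ < ∞}
  zero_mem' := ⟨𝔊.toSubmodule.zero_mem, by simp⟩
  add_mem' := by
    rintro x y ⟨hx, hx2⟩ ⟨hy, hy2⟩
    refine ⟨𝔊.toSubmodule.add_mem hx hy, ?_⟩
    have hm := 𝔊.measurable_enorm hx
    calc ∫⁻ ω, ‖(x + y) ω‖ₑ ^ 2 ∂μ ≤ ∫⁻ ω, 2 * (‖x ω‖ₑ ^ 2 + ‖y ω‖ₑ ^ 2) ∂μ := by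
          refine lintegral_mono fun ω => ?_
          refine (pow_le_pow_left' (enorm_add_le (x ω) (y ω)) 2).trans ?_
          have h := ENNReal.rpow_add_le_mul_rpow_add_rpow ‖x ω‖ₑ ‖y ω‖ₑ (p := 2) (by norm_num)
          norm_num at h
          exact h
      _ = 2 * (∫⁻ ω, ‖x ω‖ₑ ^ 2 ∂μ + ∫⁻ ω, ‖y ω‖ₑ ^ 2 ∂μ) := by
          rw [lintegral_const_mul' _ _ (by simp), lintegral_add_left (hm.pow_const 2)]
      _ < ∞ := ENNReal.mul_lt_top (by simp) (ENNReal.add_lt_top.2 ⟨hx2, hy2⟩)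
  smul_mem' := by
    rintro c x ⟨hx, hx2⟩
    refine ⟨𝔊.toSubmodule.smul_mem c hx, ?_⟩
    have h : ∀ ω, ‖(c • x) ω‖ₑ ^ 2 = ‖c‖ₑ ^ 2 * ‖x ω‖ₑ ^ 2 := fun ω => by
      rw [Pi.smul_apply, enorm_smul, mul_pow]
    simp_rw [h]
    rw [lintegral_const_mul' _ _ (by simp)]
    exact ENNReal.mul_lt_top (by simp) hx2

theorem integrable_norm_sq (𝔊 : MeasurableVectorField H) {μ : Measure Ω} {x : ∀ ω, H ω}
    (hx : x ∈ 𝔊.squareIntegrable μ) : Integrable (fun ω => ‖x ω‖ ^ 2) μ := by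
  refine ⟨((𝔊.measurable_norm _ hx.1).pow_const 2).aestronglyMeasurable, ?_⟩
  have h := hx.2
  simpa [HasFiniteIntegral, enorm_pow] using h

theorem integrable_inner (𝔊 : MeasurableVectorField H) {μ : Measure Ω} {x y : ∀ ω, H ω}
    (hx : x ∈ 𝔊.squareIntegrable μ) (hy : y ∈ 𝔊.squareIntegrable μ) :
    Integrable (fun ω => inner ℝ (x ω) (y ω)) μ := by
  refine ((𝔊.integrable_norm_sq hx).add (𝔊.integrable_norm_sq hy)).mono'
    (𝔊.measurable_inner hx.1 hy.1).aestronglyMeasurable (ae_of_all _ fun ω => ?_)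
  have h := norm_inner_le_norm (𝕜 := ℝ) (x ω) (y ω)
  simp only [Pi.add_apply]
  nlinarith [sq_nonneg (‖x ω‖ - ‖y ω‖), norm_nonneg (x ω), norm_nonneg (y ω)]

/-- The mappings in `𝔥` that vanish `μ`-almost everywhere. -/
def null (𝔊 : MeasurableVectorField H) (μ : Measure Ω) :
    Submodule ℝ (𝔊.squareIntegrable μ) where
  carrier := {x | ∀ᵐ ω ∂μ, x.1 ω = 0}
  zero_mem' := ae_of_all _ fun _ => rfl
  add_mem' := by
    intro x y hx hy
    change ∀ᵐ ω ∂μ, (x + y).1 ω = 0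
    filter_upwards [hx, hy] with ω h1 h2
    simp [h1, h2]
  smul_mem' := by
    intro c x hx
    change ∀ᵐ ω ∂μ, (c • x).1 ω = 0
    filter_upwards [hx] with ω h
    simp [h]

/-- The Hilbert direct integral: the space of classes of `μ`-a.e. equal mappings in `𝔥`. -/
def DirectIntegral (𝔊 : MeasurableVectorField H) (μ : Measure Ω) : Type _ :=
  𝔊.squareIntegrable μ ⧸ 𝔊.null μ

namespace DirectIntegral

variable {𝔊 : MeasurableVectorField H} {μ : Measure Ω}

instance : AddCommGroup (𝔊.DirectIntegral μ) :=
  inferInstanceAs (AddCommGroup (𝔊.squareIntegrable μ ⧸ 𝔊.null μ))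

instance : Module ℝ (𝔊.DirectIntegral μ) :=
  inferInstanceAs (Module ℝ (𝔊.squareIntegrable μ ⧸ 𝔊.null μ))

/-- The class of a mapping in `𝔥`. -/
def mk : 𝔊.squareIntegrable μ →ₗ[ℝ] 𝔊.DirectIntegral μ := (𝔊.null μ).mkQ

/-- A representative in `𝔥` of an element of the direct integral. -/
def rep (u : 𝔊.DirectIntegral μ) : 𝔊.squareIntegrable μ :=
  ((𝔊.null μ).mkQ_surjective u).choose

theorem mk_rep (u : 𝔊.DirectIntegral μ) : mk u.rep = u :=
  ((𝔊.null μ).mkQ_surjective u).choose_spec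

theorem mk_eq_mk_iff (x y : 𝔊.squareIntegrable μ) :
    mk x = mk y ↔ ∀ᵐ ω ∂μ, x.1 ω = y.1 ω := by
  have h : mk x = mk y ↔ x - y ∈ 𝔊.null μ := Submodule.Quotient.eq _
  rw [h]
  change (∀ᵐ ω ∂μ, (x - y : 𝔊.squareIntegrable μ).1 ω = 0) ↔ _
  refine eventually_congr (ae_of_all _ fun ω => ?_)
  exact sub_eq_zero

theorem rep_mk (x : 𝔊.squareIntegrable μ) : ∀ᵐ ω ∂μ, (mk x).rep.1 ω = x.1 ω :=
  (mk_eq_mk_iff _ _).1 (mk_rep _)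

/-- The scalar product `⟪u, v⟫ = ∫ ⟪u ω, v ω⟫ dμ`. -/
abbrev core : InnerProductSpace.Core ℝ (𝔊.DirectIntegral μ) where
  inner u v := ∫ ω, inner ℝ (u.rep.1 ω) (v.rep.1 ω) ∂μ
  conj_inner_symm u v := by
    simp only [conj_trivial]
    exact integral_congr_ae (ae_of_all _ fun ω => real_inner_comm _ _)
  re_inner_nonneg u := integral_nonneg fun ω => real_inner_self_nonneg
  add_left u v w := by
    have h : ∀ᵐ ω ∂μ, (u + v).rep.1 ω = u.rep.1 ω + v.rep.1 ω := by
      refine (mk_eq_mk_iff (u + v).rep (u.rep + v.rep)).1 ?_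
      rw [map_add, mk_rep, mk_rep, mk_rep]
    rw [← integral_add (𝔊.integrable_inner u.rep.2 w.rep.2)
      (𝔊.integrable_inner v.rep.2 w.rep.2)]
    refine integral_congr_ae ?_
    filter_upwards [h] with ω hω
    rw [hω, inner_add_left]
  smul_left u v r := by
    have h : ∀ᵐ ω ∂μ, (r • u).rep.1 ω = r • u.rep.1 ω := by
      refine (mk_eq_mk_iff (r • u).rep (r • u.rep)).1 ?_
      rw [map_smul, mk_rep, mk_rep]
    rw [conj_trivial, ← integral_const_mul]
    refine integral_congr_ae ?_
    filter_upwards [h] with ω hω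
    rw [hω, real_inner_smul_left]
  definite u hu := by
    simp only [real_inner_self_eq_norm_sq] at hu
    rw [integral_eq_zero_iff_of_nonneg (fun ω => sq_nonneg _)
      (𝔊.integrable_norm_sq u.rep.2)] at hu
    rw [← mk_rep u, ← map_zero mk, mk_eq_mk_iff]
    filter_upwards [hu] with ω hω
    simpa using hω

instance : NormedAddCommGroup (𝔊.DirectIntegral μ) :=
  (core (𝔊 := 𝔊) (μ := μ)).toNormedAddCommGroup

instance : InnerProductSpace ℝ (𝔊.DirectIntegral μ) :=
  InnerProductSpace.ofCore (core (𝔊 := 𝔊) (μ := μ)).toCore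

theorem inner_def (u v : 𝔊.DirectIntegral μ) :
    inner ℝ u v = ∫ ω, inner ℝ (u.rep.1 ω) (v.rep.1 ω) ∂μ := rfl

theorem enorm_mk_sq (x : 𝔊.squareIntegrable μ) :
    ‖mk x‖ₑ ^ 2 = ∫⁻ ω, ‖x.1 ω‖ₑ ^ 2 ∂μ := by
  have h : ‖mk x‖ ^ 2 = ∫ ω, ‖x.1 ω‖ ^ 2 ∂μ := by
    rw [← real_inner_self_eq_norm_sq, inner_def]
    refine integral_congr_ae ?_
    filter_upwards [rep_mk x] with ω hω
    rw [hω, real_inner_self_eq_norm_sq]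
  rw [← ofReal_norm, ← ENNReal.ofReal_pow (norm_nonneg _), h,
    ofReal_integral_eq_lintegral_ofReal (𝔊.integrable_norm_sq x.2)
      (ae_of_all _ fun ω => sq_nonneg _)]
  refine lintegral_congr fun ω => ?_
  rw [ENNReal.ofReal_pow (norm_nonneg _), ofReal_norm]

theorem lintegral_tsum_sq_le (h : ℕ → Ω → ℝ≥0∞) (hm : ∀ n, Measurable (h n)) (c : ℕ → ℝ≥0∞)
    (hc : ∀ n, ∫⁻ ω, h n ω ^ 2 ∂μ ≤ c n ^ 2) :
    ∫⁻ ω, (∑' n, h n ω) ^ 2 ∂μ ≤ (∑' n, c n) ^ 2 := by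
  have key : ∀ f : Ω → ℝ≥0∞, eLpNorm f 2 μ ^ 2 = ∫⁻ ω, f ω ^ 2 ∂μ := by
    intro f
    rw [eLpNorm_eq_lintegral_rpow_enorm_toReal (by norm_num) (by norm_num)]
    simp only [ENNReal.toReal_ofNat, ENNReal.rpow_ofNat, enorm_eq_self, one_div]
    rw [← ENNReal.rpow_natCast, ← ENNReal.rpow_mul]
    norm_num
  have hfin : ∀ N, ∫⁻ ω, (∑ n ∈ Finset.range N, h n ω) ^ 2 ∂μ ≤ (∑' n, c n) ^ 2 := by
    intro N
    have h1 := key (∑ n ∈ Finset.range N, h n)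
    simp only [Finset.sum_apply] at h1
    rw [← h1]
    refine pow_le_pow_left' ?_ 2
    refine (eLpNorm_sum_le (fun n _ => (hm n).aestronglyMeasurable) (by norm_num)).trans ?_
    refine le_trans (Finset.sum_le_sum fun n _ => ?_) (ENNReal.sum_le_tsum (Finset.range N))
    have h2 := (key (h n)).le.trans (hc n)
    exact (ENNReal.pow_le_pow_left_iff two_ne_zero).1 h2
  have hlim : ∀ ω, Tendsto (fun N => (∑ n ∈ Finset.range N, h n ω) ^ 2) atTop
      (𝓝 ((∑' n, h n ω) ^ 2)) := fun ω =>
    ((ENNReal.continuous_pow 2).tendsto _).comp (ENNReal.tendsto_nat_tsum _)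
  have hl := lintegral_tendsto_of_tendsto_of_monotone (μ := μ)
    (f := fun N ω => (∑ n ∈ Finset.range N, h n ω) ^ 2) (F := fun ω => (∑' n, h n ω) ^ 2)
    (fun N => ((Finset.measurable_sum _ fun n _ => hm n).pow_const 2).aemeasurable)
    (ae_of_all _ fun ω => fun a b hab =>
      pow_le_pow_left' (Finset.sum_le_sum_of_subset (Finset.range_mono hab)) 2)
    (ae_of_all _ hlim)
  exact le_of_tendsto' hl hfin

instance [∀ ω, CompleteSpace (H ω)] : CompleteSpace (𝔊.DirectIntegral μ) := by
  refine NormedAddCommGroup.completeSpace_of_summable_imp_tendsto fun u hu => ?_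
  have hx : ∀ n, (u n).rep.1 ∈ 𝔊.toSubmodule := fun n => (u n).rep.2.1
  have hme : ∀ n, Measurable fun ω => ‖(u n).rep.1 ω‖ₑ := fun n => 𝔊.measurable_enorm (hx n)
  have hc : ∀ n, ∫⁻ ω, ‖(u n).rep.1 ω‖ₑ ^ 2 ∂μ ≤ ‖u n‖ₑ ^ 2 := fun n => by
    rw [← enorm_mk_sq, mk_rep]
  have hsum : ∑' n, ‖u n‖ₑ ≠ ∞ := by
    have h : Summable fun n => ‖u n‖₊ := NNReal.summable_coe.1 hu
    exact ENNReal.tsum_coe_ne_top_iff_summable.2 h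
  set S : Set Ω := {ω | ∑' n, ‖(u n).rep.1 ω‖ₑ < ∞} with hS
  have hSm : MeasurableSet S := measurableSet_lt (Measurable.tsum hme) measurable_const
  have hSae : ∀ᵐ ω ∂μ, ω ∈ S := by
    have h1 := lintegral_tsum_sq_le _ hme _ hc
    have h2 : ∀ᵐ ω ∂μ, (∑' n, ‖(u n).rep.1 ω‖ₑ) ^ 2 < ∞ :=
      ae_lt_top ((Measurable.tsum hme).pow_const 2)
        (h1.trans_lt (ENNReal.pow_lt_top hsum.lt_top)).ne
    filter_upwards [h2] with ω hω
    by_contra hne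
    have h3 : ∑' n, ‖(u n).rep.1 ω‖ₑ = ∞ := by simpa [hS] using hne
    simp [h3] at hω
  have hsm : ∀ ω ∈ S, Summable fun n => (u n).rep.1 ω := fun ω hω =>
    Summable.of_nnnorm (ENNReal.tsum_coe_ne_top_iff_summable.1 (ne_of_lt hω))
  classical
  set x : ∀ ω, H ω := fun ω => if ω ∈ S then ∑' n, (u n).rep.1 ω else 0 with hxdef
  have hxG : x ∈ 𝔊.toSubmodule := by
    refine 𝔊.mem_of_measurable_inner x fun y hy => ?_
    refine measurable_of_tendsto_metrizable
      (f := fun N ω => S.indicator (fun ω => ∑ n ∈ Finset.range N,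
        inner ℝ ((u n).rep.1 ω) (y ω)) ω) (fun N => ?_) ?_
    · exact (Finset.measurable_sum _ fun n _ => 𝔊.measurable_inner (hx n) hy).indicator hSm
    · rw [tendsto_pi_nhds]
      intro ω
      by_cases hω : ω ∈ S
      · have h1 := (hsm ω hω).hasSum.tendsto_sum_nat
        have h2 := h1.inner (tendsto_const_nhds (x := y ω)) (𝕜 := ℝ)
        simpa [hxdef, hω, sum_inner] using h2
      · simp [hxdef, hω]
  have htail : ∀ N, ∫⁻ ω, ‖x ω - ∑ n ∈ Finset.range N, (u n).rep.1 ω‖ₑ ^ 2 ∂μ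
      ≤ (∑' n, ‖u (n + N)‖ₑ) ^ 2 := by
    intro N
    refine le_trans ?_ (lintegral_tsum_sq_le (fun n ω => ‖(u (n + N)).rep.1 ω‖ₑ)
      (fun n => hme (n + N)) _ fun n => hc (n + N))
    refine lintegral_mono_ae ?_
    filter_upwards [hSae] with ω hω
    refine pow_le_pow_left' ?_ 2
    have h1 : x ω - ∑ n ∈ Finset.range N, (u n).rep.1 ω = ∑' n, (u (n + N)).rep.1 ω := by
      simp only [hxdef, hω, if_true]
      rw [← (hsm ω hω).sum_add_tsum_nat_add N]
      simp
    rw [h1]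
    exact enorm_tsum_le_tsum_enorm
  have hxL : x ∈ 𝔊.squareIntegrable μ := by
    refine ⟨hxG, ?_⟩
    have h := htail 0
    simp only [Finset.range_zero, Finset.sum_empty, sub_zero, add_zero] at h
    exact h.trans_lt (ENNReal.pow_lt_top hsum.lt_top)
  refine ⟨mk ⟨x, hxL⟩, ?_⟩
  rw [tendsto_iff_edist_tendsto_0]
  have h0 := ENNReal.tendsto_sum_nat_add (fun n => ‖u n‖ₑ) hsum
  refine tendsto_of_tendsto_of_tendsto_of_le_of_le tendsto_const_nhds h0
    (fun _ => zero_le) fun N => ?_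
  have h1 : (∑ i ∈ Finset.range N, u i) = mk (∑ i ∈ Finset.range N, (u i).rep) := by
    rw [map_sum]
    exact Finset.sum_congr rfl fun i _ => (mk_rep _).symm
  rw [edist_comm, edist_eq_enorm_sub, h1, ← map_sub]
  refine (ENNReal.pow_le_pow_left_iff two_ne_zero).1 ?_
  rw [enorm_mk_sq]
  refine le_trans (le_of_eq ?_) (htail N)
  refine lintegral_congr fun ω => ?_
  simp [Finset.sum_apply]

end DirectIntegral

/-- The Hilbert direct integral of a family of set-valued operators `A ω : H ω → 2^(H ω)`:
`u'` belongs to the image of `u` when `u' ω ∈ A ω (u ω)` for `μ`-almost every `ω`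
(which does not depend on the representatives). -/
def directIntegralOperator (𝔊 : MeasurableVectorField H) (μ : Measure Ω)
    (A : ∀ ω, H ω → Set (H ω)) (u : 𝔊.DirectIntegral μ) : Set (𝔊.DirectIntegral μ) :=
  {u' | ∀ᵐ ω ∂μ, u'.rep.1 ω ∈ A ω (u.rep.1 ω)}

end MeasurableVectorField

/-- `T` is `τ`-cocoercive: `⟪x - y, T x - T y⟫ ≥ τ ‖T x - T y‖²` for all `x` and `y`. -/
def IsCocoercive {E : Type*} [NormedAddCommGroup E] [InnerProductSpace ℝ E] (τ : ℝ)
    (T : E → E) : Prop :=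
  ∀ x y, τ * ‖T x - T y‖ ^ 2 ≤ inner ℝ (x - y) (T x - T y)

/-- The integral `∫ R ω dμ` of a family of operators, `x ↦ ∫ R ω x dμ`, on its domain: the points
`x` such that `ω ↦ R ω x` is measurable and `∫ ‖R ω x‖ dμ < ∞`. -/
def integralOperatorDomain {Ω : Type*} [MeasurableSpace Ω] {E F : Type*} [NormedAddCommGroup F]
    (R : Ω → E → F) (μ : Measure Ω) : Set E :=
  {x | StronglyMeasurable (fun ω => R ω x) ∧ ∫⁻ ω, ‖R ω x‖ₑ ∂μ < ∞}

/-- The values `∫ R ω x dμ` of the integral of a family of operators. They are meaningful for `x`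
in `integralOperatorDomain R μ`. -/
def integralOperator {Ω : Type*} [MeasurableSpace Ω] {E F : Type*} [NormedAddCommGroup F]
    [NormedSpace ℝ F] (R : Ω → E → F) (μ : Measure Ω) (x : E) : F :=
  ∫ ω, R ω x ∂μ

end

/-!
The integrals `∫ (L ω)* (y ω) dμ`, for `y` square-integrable, are the values at the class of `y`
of the adjoint of the bounded operator `x ↦ [ω ↦ L ω x]` from `X` to the direct integral
(`MeasurableVectorField.adjoint_evalOperator_mk`). Their integrands are measurable by Pettis'
theorem (`stronglyMeasurable_of_measurable_inner`), since pairing with `x` gives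
`⟪L ω x, y ω⟫`. The Lipschitz bounds on `T ω` make `ω ↦ T ω (x ω)` square-integrable whenever `x`
is, so the direct integral of the `T ω` is everywhere defined, and everything about
`S = ∫ (L ω)* ∘ T ω ∘ L ω dμ` except the two range inclusions follows by integrating pointwise
inequalities; for cocoercivity the pointwise inequality is Young's, with a weight depending on `τ`.

For the range inclusions, let `v = ∫ (L ω)* (T ω (u ω)) dμ`. Cocoercivity of the `T ω` bounds
`⟪y, S y - v⟫` below, uniformly in `y`
(`MeasurableVectorField.exists_le_inner_sub_integral`). As `S` is cocoercive, the equations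
`ε x + S x = v` have solutions `x_ε`, and the lower bound at `y = x_ε` reads `ε ‖x_ε‖² ≤ K`. Hence
`ε x_ε → 0` and `S x_ε → v`, so `v` is in the closure of the range. If the lower bound also holds,
with some constant, for every `w` close to `v`, it gives `⟪x_ε, w - v⟫ ≤ K_w`; the uniform
boundedness principle then bounds `x_ε`, and monotonicity turns boundedness into strong convergence,
because `‖x_ε - x_δ‖² ≤ ‖x_δ‖² - ‖x_ε‖²` for `δ < ε`. The limit solves `S x = v`
(`IsCocoercive.mem_range_of_mem_interior`).
-/

/-! ### Measurability in separable Hilbert spaces -/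

/-- Pettis' theorem in a separable real Hilbert space: weak measurability implies strong
measurability, because the function is the limit of its partial expansions in a countable
Hilbert basis. -/
theorem stronglyMeasurable_of_measurable_inner {Ω : Type*} [MeasurableSpace Ω] {X : Type*}
    [NormedAddCommGroup X] [InnerProductSpace ℝ X] [CompleteSpace X]
    [TopologicalSpace.SeparableSpace X] {f : Ω → X}
    (hf : ∀ y, Measurable fun ω => inner ℝ y (f ω)) : StronglyMeasurable f := by
  obtain ⟨w, b, hb⟩ := exists_hilbertBasis ℝ X
  -- The open balls of radius `1 / 2` around the basis vectors are pairwise disjoint.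
  have hw : w.Countable := by
    refine Set.PairwiseDisjoint.countable_of_isOpen (s := fun x : X => Metric.ball x (1 / 2)) ?_
      (fun _ _ => Metric.isOpen_ball) fun x _ => ⟨x, Metric.mem_ball_self (by norm_num)⟩
    intro x hx y hy hxy
    refine Metric.ball_disjoint_ball ?_
    have ho := b.orthonormal
    rw [hb] at ho
    have hx1 : ‖x‖ = 1 := ho.1 ⟨x, hx⟩
    have hy1 : ‖y‖ = 1 := ho.1 ⟨y, hy⟩
    have hxy0 : inner ℝ x y = 0 :=
      ho.2 (i := ⟨x, hx⟩) (j := ⟨y, hy⟩) fun h => hxy (congrArg Subtype.val h)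
    have h := norm_sub_sq_real x y
    rw [hx1, hy1, hxy0] at h
    rw [dist_eq_norm]
    nlinarith [norm_nonneg (x - y)]
  have : Countable w := hw.to_subtype
  refine stronglyMeasurable_of_tendsto (atTop : Filter (Finset w))
    (f := fun s ω => ∑ i ∈ s, inner ℝ (b i) (f ω) • b i) (fun s => ?_) ?_
  · exact Finset.stronglyMeasurable_fun_sum _ fun i _ =>
      (hf (b i)).stronglyMeasurable.smul_const (b i)
  · rw [tendsto_pi_nhds]
    intro ω
    have h := b.hasSum_repr (f ω)
    simp only [b.repr_apply_apply] at h
    exact h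

/-- The operator norm is determined by its values on a countable dense set, hence is measurable
in the parameter. -/
theorem measurable_opNorm_of_separable {Ω : Type*} [MeasurableSpace Ω] {X : Type*}
    [NormedAddCommGroup X] [NormedSpace ℝ X] [TopologicalSpace.SeparableSpace X] {H : Ω → Type*}
    [∀ ω, NormedAddCommGroup (H ω)] [∀ ω, NormedSpace ℝ (H ω)] {L : ∀ ω, X →L[ℝ] H ω}
    (hL : ∀ x, Measurable fun ω => ‖L ω x‖) : Measurable fun ω => ‖L ω‖ := by
  refine measurable_of_Iic fun c => ?_
  rcases lt_or_ge c 0 with hc | hc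
  · convert MeasurableSet.empty
    ext ω
    simpa using hc.trans_le (norm_nonneg (L ω))
  · have h : (fun ω => ‖L ω‖) ⁻¹' Set.Iic c = ⋂ n : ℕ,
        {ω | ‖L ω (TopologicalSpace.denseSeq X n)‖ ≤ c * ‖TopologicalSpace.denseSeq X n‖} := by
      ext ω
      simp only [Set.mem_preimage, Set.mem_Iic, Set.mem_iInter, Set.mem_ofPred_eq]
      refine ⟨fun h n => (L ω).le_of_opNorm_le h _, fun h =>
        (L ω).opNorm_le_bound hc fun x => ?_⟩
      have hcl : IsClosed {x | ‖L ω x‖ ≤ c * ‖x‖} :=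
        isClosed_le (by fun_prop) (by fun_prop)
      exact (TopologicalSpace.denseRange_denseSeq X).induction_on x hcl h
    rw [h]
    exact MeasurableSet.iInter fun n => measurableSet_le (hL _) measurable_const

/-! ### Range of a cocoercive operator -/

section Cocoercive

variable {X : Type*} [NormedAddCommGroup X] [InnerProductSpace ℝ X] {S : X → X} {σ : ℝ}

theorem IsCocoercive.inner_nonneg (hσ : 0 ≤ σ) (hS : IsCocoercive σ S) (x y : X) :
    0 ≤ inner ℝ (x - y) (S x - S y) :=
  (by positivity : 0 ≤ σ * ‖S x - S y‖ ^ 2).trans (hS x y)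

/-- A cocoercive operator is maximally monotone, in Minty's form: all its Tikhonov
regularizations are onto. -/
theorem IsCocoercive.exists_smul_add_eq [CompleteSpace X] (hσ : 0 < σ) (hS : IsCocoercive σ S)
    {ε : ℝ} (hε : 0 < ε) (v : X) : ∃ x, ε • x + S x = v := by
  have hq : 0 < 1 + σ * ε := by positivity
  -- `x ↦ x - σ • S x` is nonexpansive, so dividing by `1 + σ ε` gives a strict contraction
  -- whose fixed points are the solutions.
  set g : X → X := fun x => (1 + σ * ε)⁻¹ • (x - σ • S x + σ • v) with hg
  have hne : ∀ x y, ‖(x - y) - σ • (S x - S y)‖ ≤ ‖x - y‖ := by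
    intro x y
    refine (sq_le_sq₀ (norm_nonneg _) (norm_nonneg _)).1 ?_
    rw [norm_sub_sq_real, real_inner_smul_right, norm_smul, Real.norm_eq_abs, mul_pow, sq_abs]
    nlinarith [hS x y, mul_nonneg (sq_nonneg σ) (sq_nonneg ‖S x - S y‖)]
  have hcon : ContractingWith (1 + σ * ε)⁻¹.toNNReal g := by
    refine ⟨?_, LipschitzWith.of_dist_le_mul fun x y => ?_⟩
    · rw [Real.toNNReal_lt_one]
      exact inv_lt_one_of_one_lt₀ (by nlinarith [mul_pos hσ hε])
    · rw [Real.coe_toNNReal _ (inv_nonneg.2 hq.le), dist_eq_norm, dist_eq_norm, hg]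
      have h : (1 + σ * ε)⁻¹ • (x - σ • S x + σ • v) - (1 + σ * ε)⁻¹ • (y - σ • S y + σ • v)
          = (1 + σ * ε)⁻¹ • ((x - y) - σ • (S x - S y)) := by module
      simp only [h]
      rw [norm_smul, Real.norm_of_nonneg (inv_nonneg.2 hq.le)]
      exact mul_le_mul_of_nonneg_left (hne x y) (inv_nonneg.2 hq.le)
  refine ⟨hcon.fixedPoint g, ?_⟩
  have hx : g (hcon.fixedPoint g) = hcon.fixedPoint g := hcon.fixedPoint_isFixedPt
  generalize hcon.fixedPoint g = x at hx
  have h1 : x - σ • S x + σ • v = (1 + σ * ε) • x := by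
    conv_rhs => rw [← hx, hg]
    simp only
    rw [smul_inv_smul₀ hq.ne']
  refine smul_right_injective X hσ.ne' ?_
  have h2 : σ • v = (1 + σ * ε) • x - x + σ • S x := by rw [← h1]; abel
  simp only [h2]
  module

/-- Along the regularization path the norm increases as the parameter decreases, and controls
the distance between points of the path. -/
theorem norm_sub_sq_le_of_smul_add_eq (hS : ∀ x y, 0 ≤ inner ℝ (x - y) (S x - S y)) {δ ε : ℝ}
    (hδ : 0 < δ) (hδε : δ < ε) {a b v : X} (ha : ε • a + S a = v) (hb : δ • b + S b = v) :
    ‖a - b‖ ^ 2 ≤ ‖b‖ ^ 2 - ‖a‖ ^ 2 := by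
  have h := hS a b
  rw [eq_sub_of_add_eq' ha, eq_sub_of_add_eq' hb, sub_sub_sub_cancel_left, inner_sub_right,
    inner_sub_left, inner_sub_left, real_inner_smul_right, real_inner_smul_right,
    real_inner_smul_right, real_inner_smul_right, real_inner_self_eq_norm_sq,
    real_inner_self_eq_norm_sq, real_inner_comm a b] at h
  have h2 := norm_sub_sq_real a b
  have h3 : (ε - δ) * ‖a - b‖ ^ 2 ≤ (ε - δ) * (‖b‖ ^ 2 - ‖a‖ ^ 2) := by
    nlinarith [mul_nonneg hδ.le (sq_nonneg ‖a - b‖)]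
  exact le_of_mul_le_mul_left h3 (sub_pos.2 hδε)

variable {v : X} {x : ℕ → X}

/-- Testing the lower bound at the points of the path gives `‖S (x n) - v‖ ^ 2 ≤ K / (n + 1)`. -/
theorem mem_closure_range_of_regularization {K : ℝ}
    (hx : ∀ n : ℕ, (1 / ((n : ℝ) + 1)) • x n + S (x n) = v)
    (hv : ∀ y, -K ≤ inner ℝ y (S y - v)) : v ∈ closure (Set.range S) := by
  refine mem_closure_of_tendsto (f := fun n => S (x n)) (b := atTop) ?_
    (Eventually.of_forall fun n => ⟨x n, rfl⟩)
  rw [tendsto_iff_norm_sub_tendsto_zero]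
  have hb : ∀ n : ℕ, ‖S (x n) - v‖ ^ 2 ≤ (1 / ((n : ℝ) + 1)) * K := by
    intro n
    have hε : 0 < 1 / ((n : ℝ) + 1) := Nat.one_div_pos_of_nat
    have h1 : S (x n) - v = -((1 / ((n : ℝ) + 1)) • x n) := by rw [← hx n]; abel
    have h2 := hv (x n)
    rw [h1, inner_neg_right, real_inner_smul_right, real_inner_self_eq_norm_sq] at h2
    rw [h1, norm_neg, norm_smul, mul_pow, Real.norm_of_nonneg hε.le]
    nlinarith
  have hs : Tendsto (fun n : ℕ => √((1 / ((n : ℝ) + 1)) * K)) atTop (𝓝 0) := by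
    have h := (tendsto_one_div_add_atTop_nhds_zero_nat (𝕜 := ℝ)).mul_const K
    simpa using h.sqrt
  exact squeeze_zero (fun _ => norm_nonneg _) (fun n => Real.le_sqrt_of_sq_le (hb n)) hs

/-- A bounded regularization path of a continuous monotone operator converges strongly, to a
solution of the limit equation. -/
theorem mem_range_of_bounded_regularization [CompleteSpace X] (hc : Continuous S)
    (hS : ∀ x y, 0 ≤ inner ℝ (x - y) (S x - S y))
    (hx : ∀ n : ℕ, (1 / ((n : ℝ) + 1)) • x n + S (x n) = v) {B : ℝ} (hB : ∀ n, ‖x n‖ ≤ B) :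
    v ∈ Set.range S := by
  have hmn : ∀ m n, m ≤ n → ‖x m - x n‖ ^ 2 ≤ ‖x n‖ ^ 2 - ‖x m‖ ^ 2 := by
    intro m n hmn
    rcases hmn.eq_or_lt with rfl | hlt
    · simp
    · exact norm_sub_sq_le_of_smul_add_eq hS Nat.one_div_pos_of_nat
        (Nat.one_div_lt_one_div hlt) (hx m) (hx n)
  have hmono : Monotone fun n => ‖x n‖ ^ 2 := fun m n h => by
    have := hmn m n h
    nlinarith [sq_nonneg ‖x m - x n‖]
  have hbdd : BddAbove (Set.range fun n => ‖x n‖ ^ 2) :=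
    ⟨B ^ 2, by rintro _ ⟨n, rfl⟩; exact pow_le_pow_left₀ (norm_nonneg _) (hB n) 2⟩
  have hN := (tendsto_atTop_ciSup hmono hbdd).cauchySeq
  have hcau : CauchySeq x := by
    rw [Metric.cauchySeq_iff'] at hN ⊢
    intro ε hε
    obtain ⟨N, hN⟩ := hN (ε ^ 2) (by positivity)
    refine ⟨N, fun n hn => ?_⟩
    have h1 := hN n hn
    rw [Real.dist_eq] at h1
    have h2 := hmn N n hn
    rw [dist_comm, dist_eq_norm]
    exact lt_of_pow_lt_pow_left₀ 2 hε.le (h2.trans_lt ((le_abs_self _).trans_lt h1))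
  obtain ⟨a, ha⟩ := cauchySeq_tendsto_of_complete hcau
  refine ⟨a, ?_⟩
  have h0 := (tendsto_one_div_add_atTop_nhds_zero_nat (𝕜 := ℝ)).smul ha
  have h1 := h0.add ((hc.tendsto a).comp ha)
  simp only [Function.comp_def, hx, zero_smul, zero_add] at h1
  exact tendsto_nhds_unique h1 tendsto_const_nhds

/-- If `y ↦ ⟪y, S y - v⟫` is bounded below then `v` lies in the closure of the range of `S`. -/
theorem IsCocoercive.mem_closure_range [CompleteSpace X] (hσ : 0 < σ) (hS : IsCocoercive σ S)
    {K : ℝ} (hv : ∀ y, -K ≤ inner ℝ y (S y - v)) : v ∈ closure (Set.range S) := by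
  choose x hx using fun n : ℕ =>
    hS.exists_smul_add_eq hσ (Nat.one_div_pos_of_nat (α := ℝ) (n := n)) v
  exact mem_closure_range_of_regularization hx hv

/-- If the lower bound on `y ↦ ⟪y, S y - w⟫` is available for every `w` near `v`, then the
regularization path at `v` is weakly bounded, hence bounded by the uniform boundedness
principle, and `v` is a value of `S`. -/
theorem IsCocoercive.mem_range_of_mem_interior [CompleteSpace X] (hσ : 0 < σ)
    (hS : IsCocoercive σ S) (hc : Continuous S) {C : Set X}
    (hC : ∀ w ∈ C, ∃ K, ∀ y, -K ≤ inner ℝ y (S y - w)) (hv : v ∈ interior C) :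
    v ∈ Set.range S := by
  choose x hx using fun n : ℕ =>
    hS.exists_smul_add_eq hσ (Nat.one_div_pos_of_nat (α := ℝ) (n := n)) v
  obtain ⟨r, hr, hball⟩ := Metric.mem_nhds_iff.1 (mem_interior_iff_mem_nhds.1 hv)
  have hone : ∀ w : X, ∃ K, ∀ n, inner ℝ (x n) w ≤ K := by
    intro w
    set c : ℝ := r / (2 * (‖w‖ + 1)) with hcdef
    have hw : 0 < ‖w‖ + 1 := by positivity
    have hc0 : 0 < c := by positivity
    have hmem : v + c • w ∈ C := by
      refine hball ?_
      rw [Metric.mem_ball, dist_eq_norm, add_sub_cancel_left, norm_smul,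
        Real.norm_of_nonneg hc0.le, hcdef, div_mul_eq_mul_div, div_lt_iff₀ (by positivity)]
      nlinarith [norm_nonneg w]
    obtain ⟨K, hK⟩ := hC _ hmem
    refine ⟨K / c, fun n => ?_⟩
    have hε : 0 < 1 / ((n : ℝ) + 1) := Nat.one_div_pos_of_nat
    have h1 : S (x n) - (v + c • w) = -((1 / ((n : ℝ) + 1)) • x n) - c • w := by
      rw [← hx n]; abel
    have h2 := hK (x n)
    rw [h1, inner_sub_right, inner_neg_right, real_inner_smul_right, real_inner_smul_right,
      real_inner_self_eq_norm_sq] at h2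
    rw [le_div_iff₀ hc0]
    nlinarith [mul_nonneg hε.le (sq_nonneg ‖x n‖)]
  obtain ⟨B, hB⟩ := banach_steinhaus (g := fun n => innerSL ℝ (x n)) fun w => by
    obtain ⟨K₁, h₁⟩ := hone w
    obtain ⟨K₂, h₂⟩ := hone (-w)
    refine ⟨max K₁ K₂, fun n => ?_⟩
    rw [innerSL_apply_apply, Real.norm_eq_abs, abs_le']
    refine ⟨(h₁ n).trans (le_max_left _ _), ?_⟩
    have h := h₂ n
    rw [inner_neg_right] at h
    exact h.trans (le_max_right _ _)
  exact mem_range_of_bounded_regularization hc (hS.inner_nonneg hσ.le) hx (B := B)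
    fun n => by simpa using hB n

end Cocoercive

/-! ### Square-integrable vector fields and fields of operators -/

namespace MeasurableVectorField

variable {Ω : Type*} [MeasurableSpace Ω] {H : Ω → Type*}
  [∀ ω, NormedAddCommGroup (H ω)] [∀ ω, InnerProductSpace ℝ (H ω)]
  {𝔊 : MeasurableVectorField H} {μ : Measure Ω}

theorem mem_squareIntegrable_of_integrable {x : ∀ ω, H ω} (hx : x ∈ 𝔊.toSubmodule)
    (hi : Integrable (fun ω => ‖x ω‖ ^ 2) μ) : x ∈ 𝔊.squareIntegrable μ := by
  refine ⟨hx, ?_⟩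
  have h := hi.2
  simpa [HasFiniteIntegral, enorm_pow] using h

/-- Square integrability of `x` passes to `T x` when the Lipschitz constants are essentially
bounded and one image `T z` is square-integrable. -/
theorem comp_mem_squareIntegrable {β : Ω → ℝ} (hβ : ∀ ω, 0 ≤ β ω) {B : ℝ}
    (hB : ∀ᵐ ω ∂μ, β ω ≤ B) {T : ∀ ω, H ω → H ω}
    (hT : ∀ ω, LipschitzWith (β ω).toNNReal (T ω)) {x z : ∀ ω, H ω}
    (hx : x ∈ 𝔊.squareIntegrable μ) (hTx : (fun ω => T ω (x ω)) ∈ 𝔊.toSubmodule)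
    (hz : z ∈ 𝔊.squareIntegrable μ) (hTz : (fun ω => T ω (z ω)) ∈ 𝔊.squareIntegrable μ) :
    (fun ω => T ω (x ω)) ∈ 𝔊.squareIntegrable μ := by
  refine mem_squareIntegrable_of_integrable hTx ?_
  refine (((𝔊.integrable_norm_sq (Submodule.sub_mem _ hx hz)).const_mul (2 * B ^ 2)).add
    ((𝔊.integrable_norm_sq hTz).const_mul 2)).mono'
    ((𝔊.measurable_norm _ hTx).pow_const 2).aestronglyMeasurable ?_
  filter_upwards [hB] with ω hω
  have h1 := (hT ω).dist_le_mul (x ω) (z ω)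
  rw [Real.coe_toNNReal _ (hβ ω), dist_eq_norm, dist_eq_norm] at h1
  have h2 : ‖T ω (x ω)‖ ≤ B * ‖x ω - z ω‖ + ‖T ω (z ω)‖ := by
    have h3 := norm_le_norm_sub_add (T ω (x ω)) (T ω (z ω))
    have h4 := mul_le_mul_of_nonneg_right hω (norm_nonneg (x ω - z ω))
    linarith
  rw [Real.norm_of_nonneg (sq_nonneg _)]
  have h5 := pow_le_pow_left₀ (norm_nonneg _) h2 2
  simp only [Pi.add_apply, Pi.sub_apply]
  nlinarith [sq_nonneg (B * ‖x ω - z ω‖ - ‖T ω (z ω)‖)]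

theorem DirectIntegral.inner_mk (x y : 𝔊.squareIntegrable μ) :
    inner ℝ (DirectIntegral.mk x) (DirectIntegral.mk y) = ∫ ω, inner ℝ (x.1 ω) (y.1 ω) ∂μ := by
  rw [DirectIntegral.inner_def]
  refine integral_congr_ae ?_
  filter_upwards [DirectIntegral.rep_mk x, DirectIntegral.rep_mk y] with ω h1 h2
  rw [h1, h2]

theorem DirectIntegral.norm_mk_sq (x : 𝔊.squareIntegrable μ) :
    ‖DirectIntegral.mk x‖ ^ 2 = ∫ ω, ‖x.1 ω‖ ^ 2 ∂μ := by
  rw [← real_inner_self_eq_norm_sq, DirectIntegral.inner_mk]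
  simp only [real_inner_self_eq_norm_sq]

section NemytskiiOperator

variable {T : ∀ ω, H ω → H ω}
  (hT : ∀ x ∈ 𝔊.squareIntegrable μ, (fun ω => T ω (x ω)) ∈ 𝔊.squareIntegrable μ)

/-- The single-valued direct integral of everywhere defined operators preserving
square-integrable mappings: it applies `T ω` pointwise to a representative. -/
noncomputable def DirectIntegral.superposition (u : 𝔊.DirectIntegral μ) : 𝔊.DirectIntegral μ :=
  DirectIntegral.mk ⟨fun ω => T ω (u.rep.1 ω), hT _ u.rep.2⟩

theorem DirectIntegral.superposition_mk (x : 𝔊.squareIntegrable μ) :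
    superposition hT (mk x) = mk ⟨fun ω => T ω (x.1 ω), hT _ x.2⟩ := by
  refine (mk_eq_mk_iff _ _).2 ?_
  filter_upwards [rep_mk x] with ω hω
  simp only [hω]

theorem directIntegralOperator_singleton (u : 𝔊.DirectIntegral μ) :
    𝔊.directIntegralOperator μ (fun ω y => {T ω y}) u = {DirectIntegral.superposition hT u} := by
  ext u'
  have h := DirectIntegral.mk_eq_mk_iff u'.rep ⟨fun ω => T ω (u.rep.1 ω), hT _ u.rep.2⟩
  rw [DirectIntegral.mk_rep] at h
  exact h.symm

end NemytskiiOperator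

variable {X : Type*} [NormedAddCommGroup X] [InnerProductSpace ℝ X] {L : ∀ ω, X →L[ℝ] H ω}

theorem apply_mem_squareIntegrable (hLmem : ∀ x : X, (fun ω => L ω x) ∈ 𝔊.toSubmodule)
    (hLint : Integrable (fun ω => ‖L ω‖ ^ 2) μ) (x : X) :
    (fun ω => L ω x) ∈ 𝔊.squareIntegrable μ := by
  refine mem_squareIntegrable_of_integrable (hLmem x) ?_
  refine (hLint.mul_const (‖x‖ ^ 2)).mono'
    ((𝔊.measurable_norm _ (hLmem x)).pow_const 2).aestronglyMeasurable (ae_of_all _ fun ω => ?_)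
  rw [Real.norm_of_nonneg (sq_nonneg _), ← mul_pow]
  exact pow_le_pow_left₀ (norm_nonneg _) ((L ω).le_opNorm x) 2

theorem integrable_opNorm_sq [TopologicalSpace.SeparableSpace X]
    (hLmem : ∀ x : X, (fun ω => L ω x) ∈ 𝔊.toSubmodule)
    (hLint : ∫⁻ ω, ‖L ω‖ₑ ^ 2 ∂μ < ∞) : Integrable (fun ω => ‖L ω‖ ^ 2) μ := by
  refine ⟨((measurable_opNorm_of_separable fun x =>
    𝔊.measurable_norm _ (hLmem x)).pow_const 2).aestronglyMeasurable, ?_⟩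
  simpa [HasFiniteIntegral, enorm_pow] using hLint

/-- The bounded operator from `X` to the direct integral sending `x` to the class of
`ω ↦ L ω x`. -/
noncomputable def evalOperator (hLmem : ∀ x : X, (fun ω => L ω x) ∈ 𝔊.toSubmodule)
    (hLint : Integrable (fun ω => ‖L ω‖ ^ 2) μ) : X →L[ℝ] 𝔊.DirectIntegral μ :=
  LinearMap.mkContinuous
    (DirectIntegral.mk ∘ₗ
      { toFun := fun x => ⟨fun ω => L ω x, apply_mem_squareIntegrable hLmem hLint x⟩
        map_add' := fun x y => Subtype.ext (funext fun ω => (L ω).map_add x y)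
        map_smul' := fun c x => Subtype.ext (funext fun ω => (L ω).map_smul c x) })
    (√(∫ ω, ‖L ω‖ ^ 2 ∂μ)) fun x => by
      refine (sq_le_sq₀ (norm_nonneg _) (by positivity)).1 ?_
      rw [mul_pow, Real.sq_sqrt (integral_nonneg fun ω => sq_nonneg _), ← integral_mul_const]
      refine (DirectIntegral.norm_mk_sq _).le.trans ?_
      refine integral_mono
        (𝔊.integrable_norm_sq (apply_mem_squareIntegrable hLmem hLint x))
        (hLint.mul_const _) fun ω => ?_
      simp only [← mul_pow]
      exact pow_le_pow_left₀ (norm_nonneg _) ((L ω).le_opNorm x) 2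

theorem evalOperator_apply (hLmem : ∀ x : X, (fun ω => L ω x) ∈ 𝔊.toSubmodule)
    (hLint : Integrable (fun ω => ‖L ω‖ ^ 2) μ) (x : X) :
    evalOperator hLmem hLint x
      = DirectIntegral.mk ⟨fun ω => L ω x, apply_mem_squareIntegrable hLmem hLint x⟩ := rfl

theorem norm_evalOperator_le (hLmem : ∀ x : X, (fun ω => L ω x) ∈ 𝔊.toSubmodule)
    (hLint : Integrable (fun ω => ‖L ω‖ ^ 2) μ) :
    ‖evalOperator hLmem hLint‖ ≤ √(∫ ω, ‖L ω‖ ^ 2 ∂μ) :=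
  LinearMap.mkContinuous_norm_le _ (Real.sqrt_nonneg _) _

variable [CompleteSpace X] [∀ ω, CompleteSpace (H ω)]

theorem stronglyMeasurable_adjoint_apply [TopologicalSpace.SeparableSpace X]
    (hLmem : ∀ x : X, (fun ω => L ω x) ∈ 𝔊.toSubmodule) {y : ∀ ω, H ω}
    (hy : y ∈ 𝔊.toSubmodule) : StronglyMeasurable fun ω => (L ω).adjoint (y ω) := by
  refine stronglyMeasurable_of_measurable_inner fun w => ?_
  simp only [ContinuousLinearMap.adjoint_inner_right]
  exact 𝔊.measurable_inner (hLmem w) hy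

theorem integrable_adjoint_apply [TopologicalSpace.SeparableSpace X]
    (hLmem : ∀ x : X, (fun ω => L ω x) ∈ 𝔊.toSubmodule)
    (hLint : Integrable (fun ω => ‖L ω‖ ^ 2) μ) {y : ∀ ω, H ω}
    (hy : y ∈ 𝔊.squareIntegrable μ) : Integrable (fun ω => (L ω).adjoint (y ω)) μ := by
  refine (hLint.add (𝔊.integrable_norm_sq hy)).mono'
    (stronglyMeasurable_adjoint_apply hLmem hy.1).aestronglyMeasurable (ae_of_all _ fun ω => ?_)
  have h := (L ω).adjoint.le_opNorm (y ω)
  rw [LinearIsometryEquiv.norm_map] at h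
  simp only [Pi.add_apply]
  nlinarith [sq_nonneg (‖L ω‖ - ‖y ω‖), norm_nonneg (L ω), norm_nonneg (y ω)]

theorem inner_integral_adjoint_apply [TopologicalSpace.SeparableSpace X]
    (hLmem : ∀ x : X, (fun ω => L ω x) ∈ 𝔊.toSubmodule)
    (hLint : Integrable (fun ω => ‖L ω‖ ^ 2) μ) {y : ∀ ω, H ω}
    (hy : y ∈ 𝔊.squareIntegrable μ) (w : X) :
    inner ℝ w (∫ ω, (L ω).adjoint (y ω) ∂μ) = ∫ ω, inner ℝ (L ω w) (y ω) ∂μ := by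
  rw [← integral_inner (integrable_adjoint_apply hLmem hLint hy)]
  simp only [ContinuousLinearMap.adjoint_inner_right]

theorem adjoint_evalOperator_mk [TopologicalSpace.SeparableSpace X]
    (hLmem : ∀ x : X, (fun ω => L ω x) ∈ 𝔊.toSubmodule)
    (hLint : Integrable (fun ω => ‖L ω‖ ^ 2) μ) (y : 𝔊.squareIntegrable μ) :
    (evalOperator hLmem hLint).adjoint (DirectIntegral.mk y)
      = ∫ ω, (L ω).adjoint (y.1 ω) ∂μ := by
  refine ext_inner_left ℝ fun w => ?_
  rw [ContinuousLinearMap.adjoint_inner_right, evalOperator_apply, DirectIntegral.inner_mk,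
    inner_integral_adjoint_apply hLmem hLint y.2]

theorem integral_adjoint_apply_sub [TopologicalSpace.SeparableSpace X]
    (hLmem : ∀ x : X, (fun ω => L ω x) ∈ 𝔊.toSubmodule)
    (hLint : Integrable (fun ω => ‖L ω‖ ^ 2) μ) {y z : ∀ ω, H ω}
    (hy : y ∈ 𝔊.squareIntegrable μ) (hz : z ∈ 𝔊.squareIntegrable μ) :
    (∫ ω, (L ω).adjoint (y ω) ∂μ) - ∫ ω, (L ω).adjoint (z ω) ∂μ
      = ∫ ω, (L ω).adjoint ((y - z) ω) ∂μ := by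
  rw [← integral_sub (integrable_adjoint_apply hLmem hLint hy)
    (integrable_adjoint_apply hLmem hLint hz)]
  simp only [Pi.sub_apply, map_sub]

/-! ### Lipschitz and cocoercivity constants of the integral operator -/

section IntegralOperator

variable [TopologicalSpace.SeparableSpace X] {β : Ω → ℝ} {T : ∀ ω, H ω → H ω}

theorem lipschitzWith_integral_adjoint_comp
    (hLmem : ∀ x : X, (fun ω => L ω x) ∈ 𝔊.toSubmodule)
    (hLint : Integrable (fun ω => ‖L ω‖ ^ 2) μ)
    (hTsq : ∀ x ∈ 𝔊.squareIntegrable μ, (fun ω => T ω (x ω)) ∈ 𝔊.squareIntegrable μ)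
    (hβ : ∀ ω, 0 ≤ β ω) (hT : ∀ ω, LipschitzWith (β ω).toNNReal (T ω))
    (hi : Integrable (fun ω => ‖L ω‖ ^ 2 * β ω) μ) :
    LipschitzWith (∫ ω, ‖L ω‖ ^ 2 * β ω ∂μ).toNNReal
      fun x => ∫ ω, (L ω).adjoint (T ω (L ω x)) ∂μ := by
  refine LipschitzWith.of_dist_le_mul fun x y => ?_
  have hx := hTsq _ (apply_mem_squareIntegrable hLmem hLint x)
  have hy := hTsq _ (apply_mem_squareIntegrable hLmem hLint y)
  rw [dist_eq_norm, integral_adjoint_apply_sub hLmem hLint hx hy,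
    Real.coe_toNNReal _ (integral_nonneg fun ω => mul_nonneg (sq_nonneg _) (hβ ω)),
    ← integral_mul_const]
  refine norm_integral_le_of_norm_le (hi.mul_const _) (ae_of_all _ fun ω => ?_)
  have h1 := (hT ω).dist_le_mul (L ω x) (L ω y)
  rw [Real.coe_toNNReal _ (hβ ω), dist_eq_norm, dist_eq_norm, ← map_sub] at h1
  have h2 := (L ω).adjoint.le_opNorm (T ω (L ω x) - T ω (L ω y))
  rw [LinearIsometryEquiv.norm_map] at h2
  rw [dist_eq_norm]
  calc _ ≤ ‖L ω‖ * ‖T ω (L ω x) - T ω (L ω y)‖ := h2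
    _ ≤ ‖L ω‖ * (β ω * (‖L ω‖ * ‖x - y‖)) := by
      refine mul_le_mul_of_nonneg_left (h1.trans ?_) (norm_nonneg _)
      exact mul_le_mul_of_nonneg_left ((L ω).le_opNorm _) (hβ ω)
    _ = ‖L ω‖ ^ 2 * β ω * ‖x - y‖ := by ring

theorem isCocoercive_integral_adjoint_comp
    (hLmem : ∀ x : X, (fun ω => L ω x) ∈ 𝔊.toSubmodule)
    (hLint : Integrable (fun ω => ‖L ω‖ ^ 2) μ)
    (hTsq : ∀ x ∈ 𝔊.squareIntegrable μ, (fun ω => T ω (x ω)) ∈ 𝔊.squareIntegrable μ)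
    (hβ : ∀ ω, 0 < β ω) (hT : ∀ ω, IsCocoercive (1 / β ω) (T ω))
    (hi : Integrable (fun ω => ‖L ω‖ ^ 2 * β ω) μ) {τ : ℝ} (hτ : 0 < τ)
    (hτi : τ = ∫ ω, ‖L ω‖ ^ 2 * β ω ∂μ) :
    IsCocoercive (1 / τ) fun x => ∫ ω, (L ω).adjoint (T ω (L ω x)) ∂μ := by
  intro x y
  have hLsq := apply_mem_squareIntegrable hLmem hLint
  have hd := Submodule.sub_mem _ (hTsq _ (hLsq x)) (hTsq _ (hLsq y))
  rw [integral_adjoint_apply_sub hLmem hLint (hTsq _ (hLsq x)) (hTsq _ (hLsq y))]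
  set d : ∀ ω, H ω := (fun ω => T ω (L ω x)) - fun ω => T ω (L ω y) with hddef
  set w := ∫ ω, (L ω).adjoint (d ω) ∂μ with hw
  -- Young's inequality, with weight `1 / τ` chosen so that the first term integrates to
  -- `‖w‖ ^ 2`; the second one is handled by the cocoercivity of `T ω`.
  have hpt : ∀ ω, 2 * inner ℝ (L ω w) (d ω)
      ≤ 1 / τ * ‖w‖ ^ 2 * (‖L ω‖ ^ 2 * β ω) + τ * inner ℝ (L ω (x - y)) (d ω) := by
    intro ω
    have h1 := hT ω (L ω x) (L ω y)
    rw [← map_sub] at h1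
    have h2 : inner ℝ (L ω w) (d ω) ≤ ‖L ω‖ * ‖w‖ * ‖d ω‖ :=
      (real_inner_le_norm _ _).trans
        (mul_le_mul_of_nonneg_right ((L ω).le_opNorm w) (norm_nonneg _))
    have h3 : 2 * (‖L ω‖ * ‖w‖ * ‖d ω‖)
        ≤ 1 / τ * ‖w‖ ^ 2 * (‖L ω‖ ^ 2 * β ω) + τ * (1 / β ω * ‖d ω‖ ^ 2) := by
      have h4 : 0 ≤ (β ω * ‖L ω‖ * ‖w‖ - τ * ‖d ω‖) ^ 2 / (τ * β ω) :=
        div_nonneg (sq_nonneg _) (mul_pos hτ (hβ ω)).le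
      have h5 : (β ω * ‖L ω‖ * ‖w‖ - τ * ‖d ω‖) ^ 2 / (τ * β ω)
          = 1 / τ * ‖w‖ ^ 2 * (‖L ω‖ ^ 2 * β ω) + τ * (1 / β ω * ‖d ω‖ ^ 2)
            - 2 * (‖L ω‖ * ‖w‖ * ‖d ω‖) := by
        have := (hβ ω).ne'
        field_simp
        ring
      linarith
    have h6 := mul_le_mul_of_nonneg_left h1 hτ.le
    change τ * (1 / β ω * ‖d ω‖ ^ 2) ≤ τ * inner ℝ (L ω (x - y)) (d ω) at h6
    linarith
  have hint1 := 𝔊.integrable_inner (hLsq w) hd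
  have hint2 := 𝔊.integrable_inner (hLsq (x - y)) hd
  have h := integral_mono (hint1.const_mul 2) ((hi.const_mul _).add (hint2.const_mul τ)) hpt
  simp only [Pi.add_apply] at h
  rw [integral_add (hi.const_mul _) (hint2.const_mul τ), integral_const_mul, integral_const_mul,
    integral_const_mul, ← inner_integral_adjoint_apply hLmem hLint hd,
    ← inner_integral_adjoint_apply hLmem hLint hd, ← hτi, ← hw, real_inner_self_eq_norm_sq] at h
  have h7 : 1 / τ * ‖w‖ ^ 2 * τ = ‖w‖ ^ 2 := by field_simp
  rw [one_div, inv_mul_le_iff₀ hτ]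
  linarith

/-- The defect of monotonicity between `S` and an integral `∫ (L ω)* (T ω (u ω)) dμ` is bounded
below uniformly in the point: cocoercivity of `T ω` absorbs the term that is linear in
`T ω (L ω y) - T ω (u ω)`. -/
theorem exists_le_inner_sub_integral
    (hLmem : ∀ x : X, (fun ω => L ω x) ∈ 𝔊.toSubmodule)
    (hLint : Integrable (fun ω => ‖L ω‖ ^ 2) μ)
    (hTsq : ∀ x ∈ 𝔊.squareIntegrable μ, (fun ω => T ω (x ω)) ∈ 𝔊.squareIntegrable μ)
    (hβ : ∀ ω, 0 < β ω) {B : ℝ} (hB : ∀ᵐ ω ∂μ, β ω ≤ B)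
    (hT : ∀ ω, IsCocoercive (1 / β ω) (T ω)) {u : ∀ ω, H ω} (hu : u ∈ 𝔊.squareIntegrable μ) :
    ∃ K, ∀ y, -K ≤ inner ℝ y ((∫ ω, (L ω).adjoint (T ω (L ω y)) ∂μ)
      - ∫ ω, (L ω).adjoint (T ω (u ω)) ∂μ) := by
  refine ⟨∫ ω, B * ‖u ω‖ ^ 2 ∂μ, fun y => ?_⟩
  have hLsq := apply_mem_squareIntegrable hLmem hLint
  have hd := Submodule.sub_mem _ (hTsq _ (hLsq y)) (hTsq _ hu)
  rw [integral_adjoint_apply_sub hLmem hLint (hTsq _ (hLsq y)) (hTsq _ hu),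
    inner_integral_adjoint_apply hLmem hLint hd, ← integral_neg]
  refine integral_mono_ae ((𝔊.integrable_norm_sq hu).const_mul B).neg
    (𝔊.integrable_inner (hLsq y) hd) ?_
  filter_upwards [hB] with ω hω
  have hβω := hβ ω
  have h1 := hT ω (L ω y) (u ω)
  rw [inner_sub_left] at h1
  simp only [Pi.sub_apply, neg_le_iff_add_nonneg]
  set e := T ω (L ω y) - T ω (u ω)
  have h2 := neg_le_of_abs_le (abs_real_inner_le_norm (u ω) e)
  have h3 : ‖u ω‖ * ‖e‖ ≤ β ω * ‖u ω‖ ^ 2 + 1 / β ω * ‖e‖ ^ 2 := by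
    have h4 : 1 / β ω * ‖e‖ ^ 2 = β ω * (1 / β ω * ‖e‖) ^ 2 := by field_simp
    have h5 : ‖e‖ = β ω * (1 / β ω * ‖e‖) := by field_simp
    rw [h4]
    nth_rewrite 1 [h5]
    generalize 1 / β ω * ‖e‖ = p
    nlinarith [mul_nonneg hβω.le (sq_nonneg (‖u ω‖ - p)), mul_nonneg hβω.le (sq_nonneg (‖u ω‖)),
      mul_nonneg hβω.le (sq_nonneg p)]
  have h6 := mul_le_mul_of_nonneg_right hω (sq_nonneg ‖u ω‖)
  linarith

end IntegralOperator

end MeasurableVectorField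

/-! ### Integrals of composite operators and their ranges -/

theorem propositionp {Ω : Type*} [MeasurableSpace Ω] (μ : Measure Ω) [μ.IsComplete]
    [SigmaFinite μ] {H : Ω → Type*} [∀ ω, NormedAddCommGroup (H ω)]
    [∀ ω, InnerProductSpace ℝ (H ω)] [∀ ω, CompleteSpace (H ω)]
    (𝔊 : MeasurableVectorField H)
    {X : Type*} [NormedAddCommGroup X] [InnerProductSpace ℝ X] [CompleteSpace X]
    [TopologicalSpace.SeparableSpace X]
    (β : Ω → ℝ) (hβpos : ∀ ω, 0 < β ω) (hβmeas : Measurable β)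
    (hβsup : essSup (fun ω => ENNReal.ofReal (β ω)) μ < ∞)
    (T : ∀ ω, H ω → H ω) (hT : ∀ ω, LipschitzWith (β ω).toNNReal (T ω))
    (L : ∀ ω, X →L[ℝ] H ω)
    (hTmem : ∀ x ∈ 𝔊.squareIntegrable μ, (fun ω => T ω (x ω)) ∈ 𝔊.toSubmodule)
    (hTz : ∃ z ∈ 𝔊.squareIntegrable μ, (fun ω => T ω (z ω)) ∈ 𝔊.squareIntegrable μ)
    (hLmem : ∀ x : X, (fun ω => L ω x) ∈ 𝔊.toSubmodule)
    (hLint : ∫⁻ ω, ‖L ω‖ₑ ^ 2 ∂μ < ∞)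
    -- `R ω = L ω* ∘ T ω ∘ L ω`, `S = ∫ R ω dμ`
    (R : Ω → X → X) (hR : ∀ ω x, R ω x = (L ω).adjoint (T ω (L ω x)))
    (S : X → X) (hS : S = integralOperator R μ)
    (τ : ℝ) (hτ : τ = ∫ ω, ‖L ω‖ ^ 2 * β ω ∂μ)
    -- `C = {∫ L ω* (T ω (x ω)) dμ | x ∈ 𝔥}`
    (C : Set X) (hC : C = {v | ∃ x ∈ 𝔊.squareIntegrable μ,
      v = ∫ ω, (L ω).adjoint (T ω (x ω)) ∂μ}) :
    -- `S : X → X` is well defined, `τ` is finite, and `S` is `τ`-Lipschitzian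
    (integralOperatorDomain R μ = Set.univ ∧
      Integrable (fun ω => ‖L ω‖ ^ 2 * β ω) μ ∧ LipschitzWith τ.toNNReal S) ∧
    -- factorization through the direct integral
    (∃ (Lhat : X →L[ℝ] 𝔊.DirectIntegral μ) (That : 𝔊.DirectIntegral μ → 𝔊.DirectIntegral μ),
      (∀ x : X, ∃ hx : (fun ω => L ω x) ∈ 𝔊.squareIntegrable μ,
        Lhat x = MeasurableVectorField.DirectIntegral.mk ⟨fun ω => L ω x, hx⟩) ∧
      (∀ u, 𝔊.directIntegralOperator μ (fun ω y => {T ω y}) u = {That u}) ∧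
      Integrable (fun ω => ‖L ω‖ ^ 2) μ ∧
      ‖Lhat‖ ≤ √(∫ ω, ‖L ω‖ ^ 2 ∂μ) ∧
      S = Lhat.adjoint ∘ That ∘ Lhat) ∧
    -- the cocoercive case
    ((∀ ω, IsCocoercive (1 / β ω) (T ω)) → (∀ ω, L ω ≠ 0) →
      ((μ ≠ 0 → 0 < τ) ∧ IsCocoercive (1 / τ) S) ∧
      (∀ x ∈ 𝔊.squareIntegrable μ,
        Integrable (fun ω => (L ω).adjoint (T ω (x ω))) μ) ∧
      C ⊆ closure (Set.range S) ∧
      interior C ⊆ Set.range S) := by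
  obtain ⟨z, hz, hTz⟩ := hTz
  have hβ0 : ∀ ω, 0 ≤ β ω := fun ω => (hβpos ω).le
  obtain ⟨B, hB⟩ : ∃ B, ∀ᵐ ω ∂μ, β ω ≤ B := by
    refine ⟨(essSup (fun ω => ENNReal.ofReal (β ω)) μ).toReal, ?_⟩
    filter_upwards [ENNReal.ae_le_essSup fun ω => ENNReal.ofReal (β ω)] with ω hω
    exact (ENNReal.ofReal_le_iff_le_toReal hβsup.ne).1 hω
  have hL2 : Integrable (fun ω => ‖L ω‖ ^ 2) μ := 𝔊.integrable_opNorm_sq hLmem hLint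
  have hLsq := 𝔊.apply_mem_squareIntegrable hLmem hL2
  have hTsq : ∀ x ∈ 𝔊.squareIntegrable μ, (fun ω => T ω (x ω)) ∈ 𝔊.squareIntegrable μ :=
    fun x hx => 𝔊.comp_mem_squareIntegrable hβ0 hB hT hx (hTmem x hx) hz hTz
  have hi : Integrable (fun ω => ‖L ω‖ ^ 2 * β ω) μ := by
    refine hL2.mul_bdd hβmeas.aestronglyMeasurable (c := B) ?_
    filter_upwards [hB] with ω hω
    rwa [Real.norm_of_nonneg (hβ0 ω)]
  obtain rfl : R = fun ω x => (L ω).adjoint (T ω (L ω x)) := funext₂ hR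
  have hS' : S = fun x => ∫ ω, (L ω).adjoint (T ω (L ω x)) ∂μ := hS
  have hLip : LipschitzWith τ.toNNReal S := by
    rw [hS', hτ]
    exact 𝔊.lipschitzWith_integral_adjoint_comp hLmem hL2 hTsq hβ0 hT hi
  refine ⟨⟨?_, hi, hLip⟩, ⟨𝔊.evalOperator hLmem hL2, .superposition hTsq,
    fun x => ⟨hLsq x, rfl⟩, 𝔊.directIntegralOperator_singleton hTsq, hL2,
    𝔊.norm_evalOperator_le hLmem hL2, ?_⟩, fun hco hLne => ?_⟩
  · refine Set.eq_univ_of_forall fun x => ⟨?_, ?_⟩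
    · exact 𝔊.stronglyMeasurable_adjoint_apply hLmem (hTsq _ (hLsq x)).1
    · exact (𝔊.integrable_adjoint_apply hLmem hL2 (hTsq _ (hLsq x))).2
  · funext x
    rw [hS', Function.comp_apply, Function.comp_apply, 𝔊.evalOperator_apply,
      MeasurableVectorField.DirectIntegral.superposition_mk, 𝔊.adjoint_evalOperator_mk]
  have hτpos : μ ≠ 0 → 0 < τ := by
    intro hμ
    have hpos : ∀ ω, 0 < ‖L ω‖ ^ 2 * β ω := fun ω =>
      mul_pos (pow_pos (norm_pos_iff.2 (hLne ω)) 2) (hβpos ω)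
    rw [hτ, integral_pos_iff_support_of_nonneg (fun ω => (hpos ω).le) hi,
      Function.support_eq_univ fun ω => (hpos ω).ne']
    exact Measure.measure_univ_pos.2 hμ
  have hadj : ∀ x ∈ 𝔊.squareIntegrable μ,
      Integrable (fun ω => (L ω).adjoint (T ω (x ω))) μ := fun x hx =>
    𝔊.integrable_adjoint_apply hLmem hL2 (hTsq x hx)
  rcases eq_or_ne μ 0 with rfl | hμ
  · -- All integrals vanish, so that `S = 0` and `C = {0}`.
    have hS0 : ∀ x, S x = 0 := fun x => by simp only [hS', integral_zero_measure]
    have hCS : C ⊆ Set.range S := by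
      rw [hC]
      rintro _ ⟨x, -, rfl⟩
      exact ⟨0, by rw [hS0, integral_zero_measure]⟩
    refine ⟨⟨hτpos, fun x y => ?_⟩, hadj, hCS.trans subset_closure,
      interior_subset.trans hCS⟩
    simp [hS0]
  · have hτ0 := hτpos hμ
    have hSco : IsCocoercive (1 / τ) S := by
      rw [hS']
      exact 𝔊.isCocoercive_integral_adjoint_comp hLmem hL2 hTsq hβpos hco hi hτ0 hτ
    have hCK : ∀ w ∈ C, ∃ K, ∀ y, -K ≤ inner ℝ y (S y - w) := by
      rw [hC, hS']
      rintro _ ⟨u, hu, rfl⟩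
      exact 𝔊.exists_le_inner_sub_integral hLmem hL2 hTsq hβpos hB hco hu
    refine ⟨⟨hτpos, hSco⟩, hadj, fun v hv => ?_, fun v hv => ?_⟩
    · obtain ⟨K, hK⟩ := hCK v hv
      exact hSco.mem_closure_range (one_div_pos.2 hτ0) hK
    · exact hSco.mem_range_of_mem_interior (one_div_pos.2 hτ0) hLip.continuous hCK hv
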